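/- Let $n \ge 2$. Notation: for $E \subset \mathbb R^n$ let $B_\varepsilon(E) = \{x + y : x \in E,\ |y| < \varepsilon\}$. For a non-negative $m \in L^1(\mathbb R^n)$ let $$\mathcal O_m = \Big\{ U \subset \mathbb R^n \text{ open} : \liminf_{\varepsilon \downarrow 0} \frac1\varepsilon \int_{U \cap B_\varepsilon(\partial U)} m \, dx < \infty \Big\}.$$ Given a finite signed Borel measure $\mu$ on $\mathbb R^n$ and a non-negative $m \in L^1(\mathbb R^n)$, a *Cauchy flux on $\mathbb R^n$ in the sense of Chen–Irving–Torres* (with production $\mu$ and majorant $m$) is a real-valued function $\mathcal F_U(S)$ of the pairs $(S,U)$ with $U \in \mathcal O_m$ and $S \subset \partial U$ Borel, such that (a) if $U, V \in \mathcal O_m$ and $A \subset \mathbb R^n$ is open with $A \cap U = A \cap V$, then $\mathcal F_U(A \cap \partial U) = \mathcal F_V(A \cap \partial V)$; (b) if $U \in \mathcal O_m$ and $S_1, S_2 \subset \partial U$ are disjoint Borel sets, then $\mathcal F_U(S_1 \cup S_2) = \mathcal F_U(S_1) + \mathcal F_U(S_2)$; (c) $\mathcal F_U(\partial U) = \mu(U)$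 for all $U \in \mathcal O_m$; (d) for all $U \in \mathcal O_m$ and Borel $S \subset \partial U$ we have $|\mathcal F_U(S)| \le \nu(S)$ for every limiting measure $\nu$ of $m$ on $\partial U$, that is, for every Borel measure $\nu$ on $\mathbb R^n$, finite on compact sets, for which there are $\varepsilon_k > 0$, $\varepsilon_k \to 0$, with $\frac1{\varepsilon_k} \int_{U \cap B_{\varepsilon_k}(\partial U)} \varphi\, m \, dx \to \int \varphi \, d\nu$ for all continuous $\varphi : \mathbb R^n \to \mathbb R$ with compact support. **Theorem.** Let $U \subset \mathbb R^n$ be a bounded Lipschitz domain (a bounded open set, connected or not, which near each of its boundary points is, after a rotation, the strict epigraph of a Lipschitz function of $n-1$ variables), and let $\sigma$ be a finite signed Borel measure on $\partial U$. Then there exist a finite signed Borel measure $\mu$ on $\mathbb R^n$, a non-negative $m \in L^1(\mathbb R^n)$, and a Cauchy flux $\mathcal F$ on $\mathbb R^n$ in the sense of Chen–Irving–Torres with production $\mu$ and majorant $m$, such that $U \in \mathcal O_m$ and $$\mathcal F_U(S) = \sigma(S) \quad \text{for all Borel sets } S \subset \partial U.$$ -/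

import Mathlib

open Set Filter Topology MeasureTheory

/-- A bounded Lipschitz domain in `ℝⁿ`: a bounded open set which near each of its boundary points
is, in suitable orthonormal coordinates, the strict epigraph of a Lipschitz function of `n - 1`
variables. Here the unit vector `e` is the vertical direction and `γ` is a function on the
hyperplane orthogonal to `e`. Connectedness is not imposed. -/
def IsBoundedLipschitzDomain {n : ℕ} (U : Set (EuclideanSpace ℝ (Fin n))) : Prop :=
  IsOpen U ∧ Bornology.IsBounded U ∧
    ∀ x₀ ∈ frontier U, ∃ r : ℝ, 0 < r ∧
      ∃ e : EuclideanSpace ℝ (Fin n), ‖e‖ = 1 ∧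
        ∃ (K : NNReal) (γ : (Submodule.span ℝ {e})ᗮ → ℝ), LipschitzWith K γ ∧
          ∀ y ∈ Metric.ball x₀ r,
            y ∈ U ↔ γ ((Submodule.span ℝ {e})ᗮ.orthogonalProjectionOnto y) < inner ℝ e y

/-- The interior `ε`-collar `U ∩ B_ε(∂U)`, with `B_ε(∂U) = ∂U + B_ε`. -/
def innerCollar {n : ℕ} (U : Set (EuclideanSpace ℝ (Fin n))) (ε : ℝ) :
    Set (EuclideanSpace ℝ (Fin n)) :=
  U ∩ Metric.thickening ε (frontier U)

/-- The admissible class `𝒪_m` in `ℝⁿ`: the open sets `U` with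
`liminf_{ε ↓ 0} (1/ε) ∫_{U ∩ B_ε(∂U)} m dx < ∞`. -/
def admissibleClass {n : ℕ} (m : EuclideanSpace ℝ (Fin n) → ℝ) :
    Set (Set (EuclideanSpace ℝ (Fin n))) :=
  {U | IsOpen U ∧
    liminf (fun ε : ℝ => (ENNReal.ofReal ε)⁻¹ * ∫⁻ x in innerCollar U ε, ENNReal.ofReal (m x))
      (𝓝[>] 0) < ⊤}

/-- `ν` is a limiting measure of `m` on `∂U`: `ν` is a Borel measure on `ℝⁿ`, finite on compact
sets, and for some sequence `ε_k > 0` with `ε_k → 0` the measures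
`(1/ε_k) m 𝓛ⁿ ⌞ (U ∩ B_{ε_k}(∂U))` converge to `ν` weakly-star, i.e. against every continuous
function with compact support. -/
def IsLimitingMeasure {n : ℕ} (m : EuclideanSpace ℝ (Fin n) → ℝ)
    (U : Set (EuclideanSpace ℝ (Fin n))) (ν : Measure (EuclideanSpace ℝ (Fin n))) : Prop :=
  IsFiniteMeasureOnCompacts ν ∧
    ∃ ε : ℕ → ℝ, (∀ k, 0 < ε k) ∧ Tendsto ε atTop (𝓝 0) ∧
      ∀ φ : EuclideanSpace ℝ (Fin n) → ℝ, Continuous φ → HasCompactSupport φ →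
        Tendsto (fun k => (ε k)⁻¹ * ∫ x in innerCollar U (ε k), φ x * m x) atTop
          (𝓝 (∫ x, φ x ∂ν))

/-- `F` is a Cauchy flux on `ℝⁿ` in the sense of Chen, Irving and Torres, with production `μ`
(a finite signed measure) and majorant `m`. The number `F U S` is the flux `𝓕_U(S)`; only its
values for `U ∈ 𝒪_m` and Borel `S ⊆ ∂U` are relevant. -/
structure IsCauchyFlux {n : ℕ} (μ : SignedMeasure (EuclideanSpace ℝ (Fin n)))
    (m : EuclideanSpace ℝ (Fin n) → ℝ)
    (F : Set (EuclideanSpace ℝ (Fin n)) → Set (EuclideanSpace ℝ (Fin n)) → ℝ) : Prop where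
  nonneg : ∀ x, 0 ≤ m x
  integrable : Integrable m
  /-- Locality. -/
  locality : ∀ U ∈ admissibleClass m, ∀ V ∈ admissibleClass m,
    ∀ A : Set (EuclideanSpace ℝ (Fin n)), IsOpen A → A ∩ U = A ∩ V →
      F U (A ∩ frontier U) = F V (A ∩ frontier V)
  /-- Additivity. -/
  additivity : ∀ U ∈ admissibleClass m, ∀ S₁ S₂ : Set (EuclideanSpace ℝ (Fin n)),
    MeasurableSet S₁ → MeasurableSet S₂ → S₁ ⊆ frontier U → S₂ ⊆ frontier U → Disjoint S₁ S₂ →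
      F U (S₁ ∪ S₂) = F U S₁ + F U S₂
  /-- Balance law. -/
  balance : ∀ U ∈ admissibleClass m, F U (frontier U) = μ U
  /-- Domination by every limiting measure. -/
  bound : ∀ U ∈ admissibleClass m, ∀ S : Set (EuclideanSpace ℝ (Fin n)),
    MeasurableSet S → S ⊆ frontier U →
      ∀ ν : Measure (EuclideanSpace ℝ (Fin n)), IsLimitingMeasure m U ν →
        ENNReal.ofReal |F U S| ≤ ν S

/-! Take a finite measure `α` on straight paths t ↦ x + tv, 0 ≤ t ≤ 1, of speed at most 1, and let
the flux through S ⊂ ∂V be the mean number of entries into V through S minus that of exits. If the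
occupation measure of the paths is m dx, this is a Cauchy flux with majorant m
(`isCauchyFlux_pathFlux`). Locality: entering V at a point depends only on V nearby. Balance: along
each path, entries minus exits is the indicator of ending in V minus that of starting in V
(`entryMeasure_univ_add`), so the production is the law of end points minus the law of initial
points. Domination: after an entry, a path of speed at most 1 remains ε-close to ∂V for time ε, so
Fatou bounds the number of entries by the liminf of the collar averages of m
(`entryMeasure_le_liminf`). Exits are entries of the reversed paths, which have the same occupation
measure.

It remains to choose `α`. By the cone condition, paths can start on ∂U with law σ⁺ and stay in U at
all times t > 0, at distance at least ρt from the complement. They enter U once, at their initial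
point, and spend time at most ε/ρ in the ε-collar, so U is admissible. Paths built likewise from σ⁻
are run backwards and leave U with law σ⁻. Spreading the velocities uniformly over a small ball
makes the occupation measure absolutely continuous. -/

open scoped ENNReal

/-! ### Counting entries and exits of a single path -/

/-- The times in `[0, 1)` at which a path, which is in a given region exactly at the times in `G`,
enters that region. -/
def entryTimes (G : Set ℝ) : Set ℝ :=
  {t | t ∈ Ico (0 : ℝ) 1 ∧ t ∉ G ∧ ∃ δ > 0, Ioo t (t + δ) ⊆ G}

/-- The entry times, together with the time `0` if the path starts inside the region. -/
def startTimes (G : Set ℝ) : Set ℝ := entryTimes G ∪ {t | t = 0 ∧ t ∈ G}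

lemma encard_startTimes (G : Set ℝ) :
    ((startTimes G).encard : ℝ≥0∞) = (entryTimes G).encard + G.indicator 1 0 := by
  have hd : Disjoint (entryTimes G) {t | t = 0 ∧ t ∈ G} := by
    rw [Set.disjoint_left]
    rintro t ht ⟨-, h⟩
    exact ht.2.1 h
  rw [startTimes, encard_union_eq hd]
  by_cases h : (0 : ℝ) ∈ G
  · have : {t : ℝ | t = 0 ∧ t ∈ G} = {0} := by
      ext t; constructor
      · rintro ⟨h, -⟩; exact h
      · rintro rfl; exact ⟨rfl, h⟩
    simp [this, h]
  · have : {t : ℝ | t = 0 ∧ t ∈ G} = ∅ := by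
      ext t; rw [iff_false_right (notMem_empty t)]
      rintro ⟨rfl, h'⟩; exact h h'
    simp [this, h]

/-- The stay in `G` that begins at `t` ends at the first later time outside `G`, which is an entry
time of the reversed path, or else lasts until time 1, where the reversed path starts inside. -/
lemma exists_exit_of_mem_startTimes {G : Set ℝ} (hG : IsOpen G) {t : ℝ} (ht : t ∈ startTimes G) :
    ∃ s, t < s ∧ Ioo t s ⊆ G ∧ 1 - s ∈ startTimes {r | 1 - r ∈ G} := by
  obtain ⟨δ, hδ, htG, ht0, ht1⟩ : ∃ δ > 0, Ioo t (t + δ) ⊆ G ∧ 0 ≤ t ∧ t < 1 := by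
    rcases ht with ht | ⟨rfl, ht⟩
    · obtain ⟨h1, -, δ, hδ, h⟩ := ht
      exact ⟨δ, hδ, h, h1.1, h1.2⟩
    · obtain ⟨δ, hδ, h⟩ := Metric.isOpen_iff.1 hG 0 ht
      refine ⟨δ, hδ, fun s hs => h ?_, le_rfl, one_pos⟩
      rw [Real.ball_eq_Ioo]
      exact ⟨by linarith [hs.1], hs.2⟩
  by_cases hB : ∃ s ∈ Ioc t 1, s ∉ G
  -- Starting at `t + δ` instead of `t` makes `B` compact, and no time is lost because the gap lies
  -- in `G`.
  · set B : Set ℝ := Icc (t + δ) 1 ∩ Gᶜ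
    have hBc : IsCompact B := isCompact_Icc.inter_right hG.isClosed_compl
    have hBmem : ∀ s ∈ Ioc t 1, s ∉ G → s ∈ B := by
      intro s hs hsG
      refine ⟨⟨?_, hs.2⟩, hsG⟩
      by_contra! hlt
      exact hsG (htG ⟨hs.1, hlt⟩)
    obtain ⟨s₀, hs₀, hs₀G⟩ := hB
    obtain ⟨s, hs, hmin⟩ := hBc.exists_isLeast ⟨s₀, hBmem s₀ hs₀ hs₀G⟩
    have hts : t < s := by linarith [hs.1.1]
    have hsub : Ioo t s ⊆ G := by
      intro r hr
      by_contra hrG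
      have := hmin (hBmem r ⟨hr.1, hr.2.le.trans hs.1.2⟩ hrG)
      linarith [hr.2]
    refine ⟨s, hts, hsub, Or.inl ⟨⟨by linarith [hs.1.2], by linarith⟩, ?_, s - t, by linarith, ?_⟩⟩
    · simpa using hs.2
    · intro r hr
      exact hsub ⟨by linarith [hr.2], by linarith [hr.1]⟩
  · push Not at hB
    refine ⟨1, ht1, fun r hr => hB r ⟨hr.1, hr.2.le⟩, Or.inr ⟨by simp, ?_⟩⟩
    simpa using hB 1 ⟨ht1, le_rfl⟩

/-- Sending a start to its exit is injective: if `t₁ < t₂` shared an exit, then `t₂` would be a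
positive time in `G`, which no start is. Applied to the reversed path as well, this gives equality.
-/
lemma encard_startTimes_le {G : Set ℝ} (hG : IsOpen G) :
    (startTimes G).encard ≤ (startTimes {r | 1 - r ∈ G}).encard := by
  choose! f hf using fun t (ht : t ∈ startTimes G) => exists_exit_of_mem_startTimes hG ht
  have key : ∀ t₁ ∈ startTimes G, ∀ t₂ ∈ startTimes G, f t₁ = f t₂ → ¬ t₁ < t₂ := by
    intro t₁ h₁ t₂ h₂ heq hlt
    have hmem : t₂ ∈ G := (hf t₁ h₁).2.1 ⟨hlt, heq ▸ (hf t₂ h₂).1⟩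
    rcases h₂ with h₂ | h₂
    · exact h₂.2.1 hmem
    · have : 0 ≤ t₁ := by
        rcases h₁ with h₁ | h₁
        · exact h₁.1.1
        · exact h₁.1.ge
      linarith [h₂.1]
  refine encard_le_encard_of_injOn (f := fun t => 1 - f t) (fun t ht => (hf t ht).2.2) ?_
  intro t₁ h₁ t₂ h₂ heq
  have heq' : f t₁ = f t₂ := by simpa using heq
  exact le_antisymm (not_lt.1 (key t₂ h₂ t₁ h₁ heq'.symm)) (not_lt.1 (key t₁ h₁ t₂ h₂ heq'))

/-- The number of entries exceeds the number of exits by one, zero or minus one, according to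
whether the path starts and ends in the region. -/
lemma encard_entryTimes_add_indicator {G : Set ℝ} (hG : IsOpen G) :
    ((entryTimes G).encard : ℝ≥0∞) + G.indicator 1 0 =
      (entryTimes {r | 1 - r ∈ G}).encard + G.indicator 1 1 := by
  have hG' : IsOpen {r : ℝ | 1 - r ∈ G} := hG.preimage (by fun_prop)
  have h := le_antisymm (encard_startTimes_le hG) (by simpa using encard_startTimes_le hG')
  have h' := encard_startTimes {r : ℝ | 1 - r ∈ G}
  rw [← h, encard_startTimes G] at h'
  rw [h']
  congr 1
  by_cases h1 : (1 : ℝ) ∈ G <;> simp [h1]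

/-- Fatou-type bound: entry times are followed by disjoint intervals in `G`. -/
lemma encard_entryTimes_inter_le_liminf {G O : Set ℝ} (hO : IsOpen O) {C : ℕ → Set ℝ}
    {ε : ℕ → ℝ} (hε : ∀ k, 0 < ε k) (hε0 : Tendsto ε atTop (𝓝 0))
    (hC : ∀ k, ∀ t ∈ entryTimes G ∩ O, ∀ s ∈ Ioo t (t + ε k), s ∈ Icc (0 : ℝ) 1 → s ∈ G → s ∈ O →
      s ∈ C k) :
    ((entryTimes G ∩ O).encard : ℝ≥0∞) ≤
      liminf (fun k => (ENNReal.ofReal (ε k))⁻¹ * volume (C k)) atTop := by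
  have hfin : ∀ T : Finset ℝ, (T : Set ℝ) ⊆ entryTimes G ∩ O →
      (T.card : ℝ≥0∞) ≤ liminf (fun k => (ENNReal.ofReal (ε k))⁻¹ * volume (C k)) atTop := by
    intro T hT
    have hδ : ∀ t ∈ T, ∀ᶠ η in 𝓝[>] (0 : ℝ), Ioo t (t + η) ⊆ Icc 0 1 ∩ G ∩ O := by
      intro t ht
      obtain ⟨⟨ht1, -, δ, hδ, hG⟩, htO⟩ := hT ht
      obtain ⟨δ', hδ', hO'⟩ := Metric.isOpen_iff.1 hO t htO
      rw [Real.ball_eq_Ioo] at hO'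
      have h1 : 0 < min (min δ δ') (1 - t) := by
        have := ht1.2
        refine lt_min (lt_min hδ hδ') (by linarith)
      filter_upwards [Ioo_mem_nhdsGT h1] with η hη s hs
      have h2 := lt_min_iff.1 hη.2
      have h3 := lt_min_iff.1 h2.1
      refine ⟨⟨⟨by linarith [hs.1, ht1.1], by linarith [hs.2]⟩, hG ⟨hs.1, by linarith [hs.2]⟩⟩,
        hO' ⟨by linarith [hs.1], by linarith [hs.2]⟩⟩
    have hall : ∀ᶠ η in 𝓝[>] (0 : ℝ), ∀ t ∈ T, Ioo t (t + η) ⊆ Icc 0 1 ∩ G ∩ O :=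
      (Finset.eventually_all T).2 hδ
    have hεt : Tendsto ε atTop (𝓝[>] 0) :=
      tendsto_nhdsWithin_iff.2 ⟨hε0, Eventually.of_forall hε⟩
    refine le_liminf_of_le (by isBoundedDefault) ?_
    filter_upwards [hεt.eventually hall] with k hk
    have hpos : ENNReal.ofReal (ε k) ≠ 0 := by simpa using hε k
    have hsub : (⋃ t ∈ T, Ioo t (t + ε k)) ⊆ C k := by
      intro s hs
      simp only [mem_iUnion] at hs
      obtain ⟨t, ht, hs⟩ := hs
      have := hk t ht hs
      exact hC k t (hT ht) s hs this.1.1 this.1.2 this.2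
    have hdisj : (T : Set ℝ).PairwiseDisjoint fun t => Ioo t (t + ε k) := by
      have aux : ∀ t₁ ∈ T, ∀ t₂ ∈ T, t₁ < t₂ → Disjoint (Ioo t₁ (t₁ + ε k)) (Ioo t₂ (t₂ + ε k)) := by
        intro t₁ h₁ t₂ h₂ hlt
        rw [Set.disjoint_left]
        intro s hs₁ hs₂
        have : t₂ ∈ G := (hk t₁ h₁ ⟨hlt, hs₂.1.trans hs₁.2⟩).1.2
        exact (hT h₂).1.2.1 this
      intro t₁ h₁ t₂ h₂ hne
      rcases lt_or_gt_of_ne hne with h | h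
      · exact aux t₁ h₁ t₂ h₂ h
      · exact (aux t₂ h₂ t₁ h₁ h).symm
    have hvol : (T.card : ℝ≥0∞) * ENNReal.ofReal (ε k) ≤ volume (C k) := by
      calc (T.card : ℝ≥0∞) * ENNReal.ofReal (ε k)
          = ∑ t ∈ T, volume (Ioo t (t + ε k)) := by simp
        _ = volume (⋃ t ∈ T, Ioo t (t + ε k)) :=
            (measure_biUnion_finset hdisj fun _ _ => measurableSet_Ioo).symm
        _ ≤ volume (C k) := measure_mono hsub
    rw [mul_comm, ← div_eq_mul_inv]
    exact (ENNReal.le_div_iff_mul_le (Or.inl hpos) (Or.inl ENNReal.ofReal_ne_top)).2 hvol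
  by_cases hf : (entryTimes G ∩ O).Finite
  · have := hfin hf.toFinset (by simp)
    rwa [hf.encard_eq_coe_toFinset_card]
  · have hinf : (entryTimes G ∩ O).encard = ⊤ := Set.encard_eq_top hf
    rw [hinf]
    refine le_of_forall_lt fun c hc => ?_
    obtain ⟨N, hN⟩ := ENNReal.exists_nat_gt (by simpa using hc.ne : c ≠ ⊤)
    obtain ⟨T, hT, hcard⟩ := (show (entryTimes G ∩ O).Infinite from hf).exists_subset_card_eq N
    exact hN.trans_le (hcard ▸ hfin T hT)

/-! ### Measurable enumeration of the entry times -/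

/-- The last time in `[0, q]` outside `G`. -/
noncomputable def lastOutside (G : Set ℝ) (q : ℝ) : ℝ := sSup (Icc 0 q \ G)

/-- At time `q ∈ (0, 1)` the path is in the region, but it was not there at some time before. -/
def IsVisit (G : Set ℝ) (q : ℝ) : Prop := q ∈ Ioo (0 : ℝ) 1 ∧ q ∈ G ∧ (Icc 0 q \ G).Nonempty

/-- The `i`-th term of the dense sequence is the first of its terms in a given visit. -/
def IsFirstVisit (G : Set ℝ) (i : ℕ) : Prop :=
  IsVisit G (TopologicalSpace.denseSeq ℝ i) ∧ ∀ j < i, IsVisit G (TopologicalSpace.denseSeq ℝ j) →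
    lastOutside G (TopologicalSpace.denseSeq ℝ j) ≠ lastOutside G (TopologicalSpace.denseSeq ℝ i)

lemma isGreatest_lastOutside {G : Set ℝ} (hG : IsOpen G) {q : ℝ} (h : (Icc 0 q \ G).Nonempty) :
    IsGreatest (Icc 0 q \ G) (lastOutside G q) :=
  (isCompact_Icc.diff hG).isGreatest_sSup h

lemma IsVisit.lastOutside_mem {G : Set ℝ} (hG : IsOpen G) {q : ℝ} (h : IsVisit G q) :
    lastOutside G q ∈ entryTimes G := by
  obtain ⟨hq, hqG, hne⟩ := h
  obtain ⟨⟨hm, hmG⟩, hub⟩ := isGreatest_lastOutside hG hne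
  have hlt : lastOutside G q < q := lt_of_le_of_ne hm.2 fun h => hmG (h.symm ▸ hqG)
  refine ⟨⟨hm.1, hlt.trans hq.2⟩, hmG, q - lastOutside G q, by linarith, fun s hs => ?_⟩
  by_contra hsG
  have := hub ⟨⟨hm.1.trans hs.1.le, by linarith [hs.2]⟩, hsG⟩
  linarith [hs.1]

lemma exists_isVisit {G : Set ℝ} (hG : IsOpen G) {t : ℝ} (ht : t ∈ entryTimes G) :
    ∃ i, IsVisit G (TopologicalSpace.denseSeq ℝ i) ∧
      lastOutside G (TopologicalSpace.denseSeq ℝ i) = t := by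
  obtain ⟨ht1, htG, δ, hδ, hsub⟩ := ht
  have hne : (Ioo t (min (t + δ) 1)).Nonempty :=
    nonempty_Ioo.2 (lt_min (by linarith) ht1.2)
  obtain ⟨i, hi⟩ := (TopologicalSpace.denseRange_denseSeq ℝ).exists_mem_open isOpen_Ioo hne
  have h2 := lt_min_iff.1 hi.2
  have hmem : t ∈ Icc 0 (TopologicalSpace.denseSeq ℝ i) \ G := ⟨⟨ht1.1, hi.1.le⟩, htG⟩
  refine ⟨i, ⟨⟨ht1.1.trans_lt hi.1, h2.2⟩, hsub ⟨hi.1, h2.1⟩, ⟨t, hmem⟩⟩, ?_⟩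
  refine (isGreatest_lastOutside hG ⟨t, hmem⟩).unique ⟨hmem, fun s hs => ?_⟩
  by_contra! hlt
  exact hs.2 (hsub ⟨hlt, by linarith [hs.1.2]⟩)

lemma exists_isFirstVisit {G : Set ℝ} (hG : IsOpen G) {t : ℝ} (ht : t ∈ entryTimes G) :
    ∃ i, IsFirstVisit G i ∧ lastOutside G (TopologicalSpace.denseSeq ℝ i) = t := by
  classical
  have h := exists_isVisit hG ht
  refine ⟨Nat.find h, ⟨(Nat.find_spec h).1, fun j hj hv heq => ?_⟩, (Nat.find_spec h).2⟩
  exact Nat.find_min h hj ⟨hv, heq.trans (Nat.find_spec h).2⟩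

/-- Each entry opens an interval in `G`, which the dense sequence meets; taking the first index per
visit counts every entry once. A count over uncountably many times becomes a countable sum whose
terms will be measurable in the path. -/
lemma encard_entryTimes_inter_eq_tsum {G : Set ℝ} (hG : IsOpen G) (T : Set ℝ) :
    ((entryTimes G ∩ T).encard : ℝ≥0∞) =
      ∑' i, {i | IsFirstVisit G i ∧
        lastOutside G (TopologicalSpace.denseSeq ℝ i) ∈ T}.indicator 1 i := by
  set I : Set ℕ := {i | IsFirstVisit G i ∧ lastOutside G (TopologicalSpace.denseSeq ℝ i) ∈ T}
  have himg : (fun i => lastOutside G (TopologicalSpace.denseSeq ℝ i)) '' I =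
      entryTimes G ∩ T := by
    ext t
    constructor
    · rintro ⟨i, ⟨hi, hiT⟩, rfl⟩
      exact ⟨hi.1.lastOutside_mem hG, hiT⟩
    · rintro ⟨ht, htT⟩
      obtain ⟨i, hi, rfl⟩ := exists_isFirstVisit hG ht
      exact ⟨i, ⟨hi, htT⟩, rfl⟩
  have hinj : InjOn (fun i => lastOutside G (TopologicalSpace.denseSeq ℝ i)) I := by
    intro i hi j hj hij
    rcases lt_trichotomy i j with h | h | h
    · exact absurd hij (hj.1.2 i h hi.1.1)
    · exact h
    · exact absurd hij.symm (hi.1.2 j h hj.1.1)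
  rw [← himg, hinj.encard_image, ← tsum_subtype I (1 : ℕ → ℝ≥0∞)]
  simp

/-! ### Straight paths and the entry measure -/

section Path

variable {E : Type*} [NormedAddCommGroup E]

/-- The straight path `p` run backwards. -/
def reversePath (p : E × E) : E × E := (p.1 + p.2, -p.2)

lemma reversePath_reversePath (p : E × E) : reversePath (reversePath p) = p := by
  simp [reversePath]

lemma continuous_reversePath : Continuous (reversePath : E × E → E × E) := by
  unfold reversePath; fun_prop

variable [NormedSpace ℝ E]

/-- The times at which the straight path with initial point `p.1` and velocity `p.2` is in `V`. -/
def pathTimes (V : Set E) (p : E × E) : Set ℝ := {t | p.1 + t • p.2 ∈ V}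

lemma IsOpen.pathTimes {V : Set E} (hV : IsOpen V) (p : E × E) : IsOpen (pathTimes V p) :=
  hV.preimage (by fun_prop)

lemma pathTimes_reversePath (V : Set E) (p : E × E) :
    pathTimes V (reversePath p) = {r | 1 - r ∈ pathTimes V p} := by
  ext t
  simp only [pathTimes, reversePath, mem_ofPred_eq]
  rw [show p.1 + p.2 + t • -p.2 = p.1 + (1 - t) • p.2 by module]

lemma mem_frontier_of_mem_entryTimes {V : Set E} (hV : IsOpen V) {p : E × E} {t : ℝ}
    (ht : t ∈ entryTimes (pathTimes V p)) : p.1 + t • p.2 ∈ frontier V := by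
  obtain ⟨-, htV, δ, hδ, hsub⟩ := ht
  rw [hV.frontier_eq]
  refine ⟨?_, htV⟩
  have hcont : Tendsto (fun s : ℝ => p.1 + s • p.2) (𝓝[>] t) (𝓝 (p.1 + t • p.2)) :=
    (Continuous.tendsto (by fun_prop) t).mono_left nhdsWithin_le_nhds
  refine mem_closure_of_tendsto hcont ?_
  filter_upwards [Ioo_mem_nhdsGT (show t < t + δ by linarith)] with s hs
  exact hsub hs

/-- Tube lemma: a path that is in the open set `V` throughout the compact `K` keeps this property
under small perturbations. All measurability in the path rests on this. -/
lemma isClosed_exists_notMem_pathTimes {V : Set E} (hV : IsOpen V) {K : Set ℝ} (hK : IsCompact K) :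
    IsClosed {p : E × E | (K \ pathTimes V p).Nonempty} := by
  rw [← isOpen_compl_iff, isOpen_iff_mem_nhds]
  intro p hp
  have hall : ∀ t ∈ K, p.1 + t • p.2 ∈ V := by
    intro t ht
    by_contra h
    exact hp ⟨t, ht, h⟩
  have hO : IsOpen {x : (E × E) × ℝ | x.1.1 + x.2 • x.1.2 ∈ V} := hV.preimage (by fun_prop)
  have := hK.eventually_forall_of_forall_eventually (x₀ := p)
    (P := fun p t => p.1 + t • p.2 ∈ V) fun t ht => hO.mem_nhds (x := (p, t)) (hall t ht)
  filter_upwards [this] with p' hp'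
  rintro ⟨t, ht, h⟩
  exact h (hp' t ht)

lemma entryTimes_inter_subset {V W A : Set E} (hA : IsOpen A) (h : A ∩ V = A ∩ W) (p : E × E) :
    entryTimes (pathTimes V p) ∩ pathTimes A p ⊆ entryTimes (pathTimes W p) ∩ pathTimes A p := by
  rintro t ⟨⟨ht, htV, δ, hδ, hsub⟩, htA⟩
  have hiff : ∀ s ∈ pathTimes A p, s ∈ pathTimes V p ↔ s ∈ pathTimes W p := by
    intro s hs
    have := Set.ext_iff.1 h (p.1 + s • p.2)
    exact ⟨fun hV => (this.1 ⟨hs, hV⟩).2, fun hW => (this.2 ⟨hs, hW⟩).2⟩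
  obtain ⟨δ', hδ', hsub'⟩ := Metric.isOpen_iff.1 (hA.pathTimes p) t htA
  rw [Real.ball_eq_Ioo] at hsub'
  refine ⟨⟨ht, fun h => htV ((hiff t htA).2 h), min δ δ', lt_min hδ hδ', fun s hs => ?_⟩, htA⟩
  have h1 := min_le_left δ δ'
  have h2 := min_le_right δ δ'
  exact (hiff s (hsub' ⟨by linarith [hs.1], by linarith [hs.2]⟩)).1
    (hsub ⟨hs.1, by linarith [hs.2]⟩)

variable [MeasurableSpace E] [BorelSpace E] [SecondCountableTopology E]

lemma measurable_lastOutside {V : Set E} (hV : IsOpen V) (q : ℝ) :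
    Measurable fun p : E × E => lastOutside (pathTimes V p) q := by
  refine measurable_of_Ici fun c => ?_
  -- The default `sSup ∅ = 0` puts the paths with no time outside `V` into the set exactly when `c ≤
  -- 0`.
  rcases le_or_gt c 0 with hc | hc
  · convert MeasurableSet.univ
    rw [eq_univ_iff_forall]
    intro p
    exact hc.trans (Real.sSup_nonneg fun t ht => ht.1.1)
  · convert (isClosed_exists_notMem_pathTimes hV (isCompact_Icc (a := c) (b := q))).measurableSet
    ext p
    constructor
    · intro h
      have hne : (Icc 0 q \ pathTimes V p).Nonempty := by
        by_contra hne
        rw [not_nonempty_iff_eq_empty] at hne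
        have h : c ≤ sSup (Icc 0 q \ pathTimes V p) := h
        rw [hne, Real.sSup_empty] at h
        linarith
      obtain ⟨h1, h2⟩ := (isGreatest_lastOutside (hV.pathTimes p) hne).1
      exact ⟨_, ⟨h, h1.2⟩, h2⟩
    · rintro ⟨t, ht, htV⟩
      have hmem : t ∈ Icc 0 q \ pathTimes V p := ⟨⟨hc.le.trans ht.1, ht.2⟩, htV⟩
      exact ht.1.trans ((isGreatest_lastOutside (hV.pathTimes p) ⟨t, hmem⟩).2 hmem)

lemma measurableSet_isVisit {V : Set E} (hV : IsOpen V) (q : ℝ) :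
    MeasurableSet {p : E × E | IsVisit (pathTimes V p) q} := by
  refine (MeasurableSet.const _).inter (MeasurableSet.inter ?_ ?_)
  · exact (hV.preimage (by fun_prop : Continuous fun p : E × E => p.1 + q • p.2)).measurableSet
  · exact (isClosed_exists_notMem_pathTimes hV isCompact_Icc).measurableSet

lemma measurableSet_isFirstVisit {V : Set E} (hV : IsOpen V) (i : ℕ) :
    MeasurableSet {p : E × E | IsFirstVisit (pathTimes V p) i} := by
  refine (measurableSet_isVisit hV _).inter ?_
  have : {p : E × E | ∀ j < i, IsVisit (pathTimes V p) (TopologicalSpace.denseSeq ℝ j) →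
      lastOutside (pathTimes V p) (TopologicalSpace.denseSeq ℝ j) ≠
        lastOutside (pathTimes V p) (TopologicalSpace.denseSeq ℝ i)} =
      ⋂ j, ⋂ (_ : j < i), ({p | IsVisit (pathTimes V p) (TopologicalSpace.denseSeq ℝ j)}ᶜ ∪
        {p | lastOutside (pathTimes V p) (TopologicalSpace.denseSeq ℝ j) =
          lastOutside (pathTimes V p) (TopologicalSpace.denseSeq ℝ i)}ᶜ) := by
    ext p
    simp [imp_iff_not_or]
  change MeasurableSet {p : E × E | ∀ j < i, _ → _}
  rw [this]
  exact MeasurableSet.iInter fun j => MeasurableSet.iInter fun _ =>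
    (measurableSet_isVisit hV _).compl.union
      (measurableSet_eq_fun (measurable_lastOutside hV _) (measurable_lastOutside hV _)).compl

/-- The distribution of the points at which the paths, distributed according to `α`, enter `V`. -/
noncomputable def entryMeasure (α : Measure (E × E)) (V : Set E) : Measure E :=
  Measure.sum fun i => (α.restrict {p | IsFirstVisit (pathTimes V p) i}).map
    fun p => p.1 + lastOutside (pathTimes V p) (TopologicalSpace.denseSeq ℝ i) • p.2

lemma measurable_entryPoint {V : Set E} (hV : IsOpen V) (q : ℝ) :
    Measurable fun p : E × E => p.1 + lastOutside (pathTimes V p) q • p.2 :=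
  measurable_fst.add ((measurable_lastOutside hV q).smul measurable_snd)

lemma measurable_encard_entryTimes {V : Set E} (hV : IsOpen V) {S : Set E} (hS : MeasurableSet S) :
    Measurable fun p : E × E =>
      ((entryTimes (pathTimes V p) ∩ pathTimes S p).encard : ℝ≥0∞) := by
  simp_rw [fun p => encard_entryTimes_inter_eq_tsum (hV.pathTimes p) (pathTimes S p)]
  refine Measurable.tsum fun i => ?_
  exact (measurable_one.indicator ((measurableSet_isFirstVisit hV i).inter
    (measurable_entryPoint hV _ hS)))

/-- Tonelli: the measure of `S` is the mean number of entries through `S`. Identities between entry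
measures thus reduce to single paths. -/
lemma entryMeasure_apply (α : Measure (E × E)) {V : Set E} (hV : IsOpen V) {S : Set E}
    (hS : MeasurableSet S) :
    entryMeasure α V S =
      ∫⁻ p, ((entryTimes (pathTimes V p) ∩ pathTimes S p).encard : ℝ≥0∞) ∂α := by
  have hm : ∀ i, MeasurableSet ({p : E × E | IsFirstVisit (pathTimes V p) i} ∩
      (fun p => p.1 + lastOutside (pathTimes V p) (TopologicalSpace.denseSeq ℝ i) • p.2) ⁻¹' S) :=
    fun i => (measurableSet_isFirstVisit hV i).inter (measurable_entryPoint hV _ hS)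
  simp_rw [fun p => encard_entryTimes_inter_eq_tsum (hV.pathTimes p) (pathTimes S p)]
  have heq : ∀ (p : E × E) (i : ℕ), {i | IsFirstVisit (pathTimes V p) i ∧
        lastOutside (pathTimes V p) (TopologicalSpace.denseSeq ℝ i) ∈
          pathTimes S p}.indicator (1 : ℕ → ℝ≥0∞) i =
      ({p : E × E | IsFirstVisit (pathTimes V p) i} ∩
        (fun p => p.1 + lastOutside (pathTimes V p) (TopologicalSpace.denseSeq ℝ i) • p.2) ⁻¹'
          S).indicator 1 p := fun _ _ => rfl
  simp_rw [heq]
  rw [lintegral_tsum fun i => (measurable_one.indicator (hm i)).aemeasurable, entryMeasure,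
    Measure.sum_apply _ hS]
  refine tsum_congr fun i => ?_
  rw [lintegral_indicator_one (hm i), Measure.map_apply (measurable_entryPoint hV _) hS,
    Measure.restrict_apply (measurable_entryPoint hV _ hS), inter_comm]

lemma entryMeasure_inter_frontier (α : Measure (E × E)) {V : Set E} (hV : IsOpen V) {S : Set E}
    (hS : MeasurableSet S) : entryMeasure α V (S ∩ frontier V) = entryMeasure α V S := by
  rw [entryMeasure_apply α hV hS,
    entryMeasure_apply α hV (hS.inter isClosed_frontier.measurableSet)]
  refine lintegral_congr fun p => ?_
  congr 2
  ext t
  exact ⟨fun h => ⟨h.1, h.2.1⟩, fun h => ⟨h.1, h.2, mem_frontier_of_mem_entryTimes hV h.1⟩⟩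

lemma entryMeasure_congr (α : Measure (E × E)) {V W A : Set E} (hV : IsOpen V) (hW : IsOpen W)
    (hA : IsOpen A) (h : A ∩ V = A ∩ W) : entryMeasure α V A = entryMeasure α W A := by
  rw [entryMeasure_apply α hV hA.measurableSet, entryMeasure_apply α hW hA.measurableSet]
  refine lintegral_congr fun p => ?_
  rw [(entryTimes_inter_subset hA h p).antisymm (entryTimes_inter_subset hA h.symm p)]

/-- Balance of entries and exits. -/
lemma entryMeasure_univ_add (α : Measure (E × E)) {V : Set E} (hV : IsOpen V) :
    entryMeasure α V univ + α.map Prod.fst V =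
      entryMeasure (α.map reversePath) V univ + α.map (fun p => p.1 + p.2) V := by
  have h1 : MeasurableSet (Prod.fst ⁻¹' V : Set (E × E)) := measurable_fst hV.measurableSet
  have hsum : Measurable fun p : E × E => p.1 + p.2 := measurable_fst.add measurable_snd
  have h2 : MeasurableSet ((fun p : E × E => p.1 + p.2) ⁻¹' V) := hsum hV.measurableSet
  rw [entryMeasure_apply α hV .univ, entryMeasure_apply _ hV .univ,
    lintegral_map (measurable_encard_entryTimes hV .univ) continuous_reversePath.measurable,
    Measure.map_apply measurable_fst hV.measurableSet, Measure.map_apply hsum hV.measurableSet,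
    ← lintegral_indicator_one h1, ← lintegral_indicator_one h2,
    ← lintegral_add_right _ (measurable_one.indicator h1),
    ← lintegral_add_right _ (measurable_one.indicator h2)]
  refine lintegral_congr fun p => ?_
  have := encard_entryTimes_add_indicator (hV.pathTimes p)
  rw [← pathTimes_reversePath] at this
  have hu : ∀ p : E × E, pathTimes univ p = univ := fun p => rfl
  rw [hu, hu, inter_univ, inter_univ]
  convert this using 2
  · by_cases h : p.1 ∈ V <;> simp [h, pathTimes]
  · by_cases h : p.1 + p.2 ∈ V <;> simp [h, pathTimes]

lemma entryMeasure_add (α β : Measure (E × E)) {V : Set E} (hV : IsOpen V) {S : Set E}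
    (hS : MeasurableSet S) :
    entryMeasure (α + β) V S = entryMeasure α V S + entryMeasure β V S := by
  simp_rw [fun α => entryMeasure_apply α hV hS, lintegral_add_measure]

end Path

/-! ### Occupation measure and its invariance under reversal -/

section Occupation

variable {E : Type*} [NormedAddCommGroup E] [NormedSpace ℝ E]
  [MeasurableSpace E] [BorelSpace E] [SecondCountableTopology E]

/-- The average occupation measure of paths distributed according to `α`. -/
noncomputable def occupation (α : Measure (E × E)) : Measure E :=
  (α.prod (volume.restrict (Icc (0 : ℝ) 1))).map fun x => x.1.1 + x.2 • x.1.2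

lemma measurable_pathPoint : Measurable fun x : (E × E) × ℝ => x.1.1 + x.2 • x.1.2 :=
  Continuous.measurable (by fun_prop)

instance (α : Measure (E × E)) [IsFiniteMeasure α] : IsFiniteMeasure (occupation α) := by
  unfold occupation; infer_instance

lemma measurableSet_pathTimes {S : Set E} (hS : MeasurableSet S) (p : E × E) :
    MeasurableSet (pathTimes S p) :=
  (measurable_pathPoint.comp measurable_prodMk_left) hS

lemma measurable_volume_pathTimes {S : Set E} (hS : MeasurableSet S) :
    Measurable fun p : E × E => volume (pathTimes S p ∩ Icc 0 1) := by
  have := measurable_measure_prodMk_left (ν := volume.restrict (Icc (0 : ℝ) 1))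
    (measurable_pathPoint hS)
  simp only [Measure.restrict_apply' measurableSet_Icc] at this
  exact this

lemma occupation_apply (α : Measure (E × E)) [SFinite α] {S : Set E} (hS : MeasurableSet S) :
    occupation α S = ∫⁻ p, volume (pathTimes S p ∩ Icc 0 1) ∂α := by
  rw [occupation, Measure.map_apply measurable_pathPoint hS,
    Measure.prod_apply (measurable_pathPoint hS)]
  simp only [Measure.restrict_apply' measurableSet_Icc]
  rfl

lemma volume_pathTimes_reversePath {S : Set E} (hS : MeasurableSet S) (p : E × E) :
    volume (pathTimes S (reversePath p) ∩ Icc 0 1) = volume (pathTimes S p ∩ Icc 0 1) := by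
  rw [← (Measure.measurePreserving_sub_left (volume : Measure ℝ) 1).measure_preimage
    ((measurableSet_pathTimes hS p).inter measurableSet_Icc).nullMeasurableSet,
    pathTimes_reversePath]
  congr 1
  ext t
  simp only [mem_inter_iff, mem_ofPred_eq, mem_preimage, mem_Icc]
  constructor
  · rintro ⟨h, h1, h2⟩; exact ⟨h, by linarith, by linarith⟩
  · rintro ⟨h, h1, h2⟩; exact ⟨h, by linarith, by linarith⟩

lemma occupation_map_reversePath (α : Measure (E × E)) [IsFiniteMeasure α] :
    occupation (α.map reversePath) = occupation α := by
  ext S hS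
  rw [occupation_apply _ hS, occupation_apply _ hS,
    lintegral_map (measurable_volume_pathTimes hS) continuous_reversePath.measurable]
  exact lintegral_congr fun p => volume_pathTimes_reversePath hS p

lemma occupation_add (α β : Measure (E × E)) [IsFiniteMeasure α] [IsFiniteMeasure β] :
    occupation (α + β) = occupation α + occupation β := by
  ext S hS
  rw [Measure.add_apply, occupation_apply _ hS, occupation_apply _ hS, occupation_apply _ hS,
    lintegral_add_measure]

end Occupation

/-! ### The Cauchy flux of a measure on paths -/

section Flux

variable {n : ℕ} {α : Measure (EuclideanSpace ℝ (Fin n) × EuclideanSpace ℝ (Fin n))}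
  {V : Set (EuclideanSpace ℝ (Fin n))} {m : EuclideanSpace ℝ (Fin n) → ℝ}

lemma measurableSet_innerCollar (hV : IsOpen V) (ε : ℝ) : MeasurableSet (innerCollar V ε) :=
  (hV.inter Metric.isOpen_thickening).measurableSet

/-- Speed at most 1 keeps a path within `ε` of its entry point for time `ε`, so the times in `V`
just after an entry are spent in the collar. The one-path bound is then integrated by Fatou's lemma.
-/
lemma entryMeasure_le_liminf [IsFiniteMeasure α] (hv : ∀ᵐ p ∂α, ‖p.2‖ ≤ 1) (hV : IsOpen V)
    {O : Set (EuclideanSpace ℝ (Fin n))} (hO : IsOpen O)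
    {ε : ℕ → ℝ} (hε : ∀ k, 0 < ε k) (hε0 : Tendsto ε atTop (𝓝 0)) :
    entryMeasure α V O ≤
      liminf (fun k => (ENNReal.ofReal (ε k))⁻¹ * occupation α (innerCollar V (ε k) ∩ O))
        atTop := by
  have hm : ∀ k, MeasurableSet (innerCollar V (ε k) ∩ O) := fun k =>
    (measurableSet_innerCollar hV _).inter hO.measurableSet
  have hint : ∀ k, (ENNReal.ofReal (ε k))⁻¹ * occupation α (innerCollar V (ε k) ∩ O) =
      ∫⁻ p, (ENNReal.ofReal (ε k))⁻¹ *
        volume (pathTimes (innerCollar V (ε k) ∩ O) p ∩ Icc 0 1) ∂α := by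
    intro k
    rw [lintegral_const_mul _ (measurable_volume_pathTimes (hm k)), occupation_apply _ (hm k)]
  simp_rw [hint]
  refine le_trans ?_ (lintegral_liminf_le fun k =>
    (measurable_volume_pathTimes (hm k)).const_mul _)
  rw [entryMeasure_apply α hV hO.measurableSet]
  refine lintegral_mono_ae ?_
  filter_upwards [hv] with p hp
  refine encard_entryTimes_inter_le_liminf (hO.pathTimes p) hε hε0 ?_
  intro k t ht s hs hs1 hsV hsO
  refine ⟨⟨⟨hsV, ?_⟩, hsO⟩, hs1⟩
  rw [Metric.mem_thickening_iff]
  refine ⟨_, mem_frontier_of_mem_entryTimes hV ht.1, ?_⟩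
  rw [dist_add_left, dist_eq_norm, ← sub_smul, norm_smul, Real.norm_eq_abs,
    abs_of_pos (by linarith [hs.1])]
  have : (s - t) * ‖p.2‖ ≤ (s - t) * 1 := mul_le_mul_of_nonneg_left hp (by linarith [hs.1])
  linarith [hs.2]

lemma entryMeasure_lt_top [IsFiniteMeasure α] (hv : ∀ᵐ p ∂α, ‖p.2‖ ≤ 1)
    (hm : occupation α = volume.withDensity fun x => ENNReal.ofReal (m x))
    (hV : V ∈ admissibleClass m) : IsFiniteMeasure (entryMeasure α V) := by
  refine ⟨?_⟩
  obtain ⟨hVo, hlim⟩ := hV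
  obtain ⟨C, hC, hCtop⟩ := exists_between hlim
  have hfreq := (frequently_lt_of_liminf_lt (by isBoundedDefault) hC).and_eventually
    self_mem_nhdsWithin
  obtain ⟨ε, hε, hεC⟩ := exists_seq_forall_of_frequently hfreq
  have hε0 : Tendsto ε atTop (𝓝 0) := hε.mono_right nhdsWithin_le_nhds
  refine lt_of_le_of_lt (entryMeasure_le_liminf hv hVo isOpen_univ (fun k => (hεC k).2) hε0) ?_
  refine lt_of_le_of_lt ?_ hCtop
  refine liminf_le_of_le (by isBoundedDefault) fun b hb => ?_
  obtain ⟨k, hk⟩ := hb.exists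
  refine hk.trans ?_
  rw [inter_univ, hm, withDensity_apply _ (measurableSet_innerCollar hVo _)]
  exact (hεC k).1.le

/-- A cutoff function turns the liminf bound into a comparison of a compact set with an open
neighbourhood. Outer regularity of `ν`, then inner regularity of the finite entry measure, carry it
to Borel sets. -/
lemma entryMeasure_le_limiting [IsFiniteMeasure α] (hv : ∀ᵐ p ∂α, ‖p.2‖ ≤ 1)
    (hm : occupation α = volume.withDensity fun x => ENNReal.ofReal (m x))
    (hm0 : ∀ x, 0 ≤ m x) (hmi : Integrable m) (hV : V ∈ admissibleClass m)
    {ν : Measure (EuclideanSpace ℝ (Fin n))} (hν : IsLimitingMeasure m V ν)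
    {S : Set (EuclideanSpace ℝ (Fin n))} (hS : MeasurableSet S) : entryMeasure α V S ≤ ν S := by
  have hVo := hV.1
  have := entryMeasure_lt_top hv hm hV
  obtain ⟨hνf, ε, hε, hε0, hlim⟩ := hν
  have key : ∀ K O : Set (EuclideanSpace ℝ (Fin n)), IsCompact K → IsOpen O → K ⊆ O →
      entryMeasure α V K ≤ ν O := by
    intro K O hK hO hKO
    -- The liminf bound needs an open set on which the cutoff equals 1; `interior K'` serves.
    obtain ⟨K', hK', hKK', hK'O⟩ := exists_compact_between hK hO hKO
    obtain ⟨φ, hφ1, hφ0, hφc, hφ⟩ := exists_continuous_one_zero_of_isCompact hK' hO.isClosed_compl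
      (disjoint_compl_right_iff_subset.2 hK'O)
    have hcpt : HasCompactSupport φ := hφc
    have hφm : ∀ x, 0 ≤ φ x * m x := fun x => mul_nonneg (hφ x).1 (hm0 x)
    have hint : Integrable fun x => φ x * m x := by
      refine hmi.bdd_mul (c := 1) φ.continuous.aestronglyMeasurable (Eventually.of_forall fun x => ?_)
      rw [Real.norm_of_nonneg (hφ x).1]
      exact (hφ x).2
    have hstep : ∀ k, (ENNReal.ofReal (ε k))⁻¹ *
        occupation α (innerCollar V (ε k) ∩ interior K') ≤
          ENNReal.ofReal ((ε k)⁻¹ * ∫ x in innerCollar V (ε k), φ x * m x) := by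
      intro k
      have hc := measurableSet_innerCollar hVo (ε k)
      rw [ENNReal.ofReal_mul (inv_nonneg.2 (hε k).le), ENNReal.ofReal_inv_of_pos (hε k),
        ofReal_integral_eq_lintegral_ofReal hint.integrableOn (Eventually.of_forall hφm), hm,
        withDensity_apply _ (hc.inter isOpen_interior.measurableSet)]
      refine mul_le_mul' le_rfl ?_
      calc ∫⁻ x in innerCollar V (ε k) ∩ interior K', ENNReal.ofReal (m x)
          = ∫⁻ x in innerCollar V (ε k) ∩ interior K', ENNReal.ofReal (φ x * m x) := by
            refine setLIntegral_congr_fun (hc.inter isOpen_interior.measurableSet) fun x hx => ?_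
            have h1 : φ x = 1 := hφ1 (interior_subset hx.2)
            simp only [h1, one_mul]
        _ ≤ ∫⁻ x in innerCollar V (ε k), ENNReal.ofReal (φ x * m x) :=
            lintegral_mono_set inter_subset_left
    have hlim' := (ENNReal.tendsto_ofReal (hlim φ φ.continuous hcpt)).liminf_eq
    calc entryMeasure α V K ≤ entryMeasure α V (interior K') := measure_mono hKK'
      _ ≤ _ := entryMeasure_le_liminf hv hVo isOpen_interior hε hε0
      _ ≤ _ := liminf_le_liminf (Eventually.of_forall hstep)
      _ = ENNReal.ofReal (∫ x, φ x ∂ν) := hlim'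
      _ = ∫⁻ x, ENNReal.ofReal (φ x) ∂ν :=
          ofReal_integral_eq_lintegral_ofReal (φ.continuous.integrable_of_hasCompactSupport hcpt)
            (Eventually.of_forall fun x => (hφ x).1)
      _ ≤ ∫⁻ x, O.indicator 1 x ∂ν := by
          refine lintegral_mono fun x => ?_
          by_cases hx : x ∈ O
          · simpa [hx] using (hφ x).2
          · have : φ x = 0 := hφ0 hx
            simp [this]
      _ = ν O := lintegral_indicator_one hO.measurableSet
  have hK : ∀ K : Set (EuclideanSpace ℝ (Fin n)), IsCompact K → entryMeasure α V K ≤ ν K := by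
    intro K hK
    rw [K.measure_eq_iInf_isOpen ν]
    refine le_iInf₂ fun O hKO => le_iInf fun hO => key K O hK hO hKO
  rw [hS.measure_eq_iSup_isCompact]
  exact iSup₂_le fun K hKS => iSup_le fun hKc => (hK K hKc).trans (measure_mono hKS)

/-- The net number of paths, distributed according to `α`, that enter `V` through `S`. -/
noncomputable def pathFlux (α : Measure (EuclideanSpace ℝ (Fin n) × EuclideanSpace ℝ (Fin n)))
    (V S : Set (EuclideanSpace ℝ (Fin n))) : ℝ :=
  (entryMeasure α V).real S - (entryMeasure (α.map reversePath) V).real S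

/-- The end points of the paths minus their initial points. -/
noncomputable def pathProduction
    (α : Measure (EuclideanSpace ℝ (Fin n) × EuclideanSpace ℝ (Fin n))) [IsFiniteMeasure α] :
    SignedMeasure (EuclideanSpace ℝ (Fin n)) :=
  (α.map fun p => p.1 + p.2).toSignedMeasure - (α.map Prod.fst).toSignedMeasure

lemma occupation_eq_withDensity [IsFiniteMeasure α] (hac : occupation α ≪ volume) :
    occupation α =
      volume.withDensity fun x => ENNReal.ofReal ((occupation α).rnDeriv volume x).toReal := by
  rw [withDensity_congr_ae (g := (occupation α).rnDeriv volume),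
    Measure.withDensity_rnDeriv_eq _ _ hac]
  filter_upwards [Measure.rnDeriv_lt_top (occupation α) volume] with x hx
  exact ENNReal.ofReal_toReal hx.ne

lemma ae_norm_map_reversePath (hv : ∀ᵐ p ∂α, ‖p.2‖ ≤ 1) :
    ∀ᵐ p ∂α.map reversePath, ‖p.2‖ ≤ 1 := by
  rw [ae_map_iff continuous_reversePath.measurable.aemeasurable
    (measurableSet_le measurable_snd.norm measurable_const)]
  simpa [reversePath] using hv

theorem isCauchyFlux_pathFlux [IsFiniteMeasure α] (hv : ∀ᵐ p ∂α, ‖p.2‖ ≤ 1)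
    (hac : occupation α ≪ volume) :
    IsCauchyFlux (pathProduction α) (fun x => ((occupation α).rnDeriv volume x).toReal)
      (pathFlux α) := by
  have hm := occupation_eq_withDensity hac
  have hm' := (occupation_map_reversePath α).trans hm
  have hv' := ae_norm_map_reversePath hv
  have hm0 : ∀ x, 0 ≤ ((occupation α).rnDeriv volume x).toReal := fun _ => ENNReal.toReal_nonneg
  have hmi : Integrable fun x => ((occupation α).rnDeriv volume x).toReal :=
    Measure.integrable_toReal_rnDeriv
  have hfin : ∀ V ∈ admissibleClass fun x => ((occupation α).rnDeriv volume x).toReal,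
      IsFiniteMeasure (entryMeasure α V) ∧
        IsFiniteMeasure (entryMeasure (α.map reversePath) V) :=
    fun V hV => ⟨entryMeasure_lt_top hv hm hV, entryMeasure_lt_top hv' hm' hV⟩
  refine ⟨hm0, hmi, ?_, ?_, ?_, ?_⟩
  · intro V hV W hW A hA h
    simp only [pathFlux, Measure.real, entryMeasure_inter_frontier _ hV.1 hA.measurableSet,
      entryMeasure_inter_frontier _ hW.1 hA.measurableSet,
      fun β => entryMeasure_congr β hV.1 hW.1 hA h]
  · intro V hV S₁ S₂ _ h₂ _ _ hd
    obtain ⟨_, _⟩ := hfin V hV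
    rw [pathFlux, measureReal_union hd h₂, measureReal_union hd h₂, pathFlux, pathFlux]
    ring
  · intro V hV
    obtain ⟨_, _⟩ := hfin V hV
    have hVm := hV.1.measurableSet
    have h : ∀ β, entryMeasure β V (frontier V) = entryMeasure β V univ := fun β => by
      have := entryMeasure_inter_frontier β hV.1 MeasurableSet.univ
      rwa [univ_inter] at this
    have hbal := congrArg ENNReal.toReal (entryMeasure_univ_add α hV.1)
    rw [ENNReal.toReal_add (measure_ne_top _ _) (measure_ne_top _ _),
      ENNReal.toReal_add (measure_ne_top _ _) (measure_ne_top _ _)] at hbal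
    rw [pathProduction, _root_.sub_apply, Measure.toSignedMeasure_apply_measurable hVm,
      Measure.toSignedMeasure_apply_measurable hVm, pathFlux]
    simp only [Measure.real, h]
    linarith
  · intro V hV S hS _ ν hν
    obtain ⟨_, _⟩ := hfin V hV
    have h1 := entryMeasure_le_limiting hv hm hm0 hmi hV hν hS
    have h2 := entryMeasure_le_limiting hv' hm' hm0 hmi hV hν hS
    rcases eq_or_ne (ν S) ⊤ with htop | htop
    · rw [htop]; exact le_top
    refine ENNReal.ofReal_le_of_le_toReal ?_
    -- Entries and exits both lie in `[0, ν S]`, hence so does the absolute value of their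
    -- difference, with no factor 2.
    exact abs_sub_le_of_nonneg_of_le ENNReal.toReal_nonneg (ENNReal.toReal_mono htop h1)
      ENNReal.toReal_nonneg (ENNReal.toReal_mono htop h2)

end Flux

/-! ### Paths leaving the boundary into a Lipschitz domain -/

section Cone

variable {n : ℕ} {U : Set (EuclideanSpace ℝ (Fin n))}

/-- The cone condition near a boundary point. -/
lemma exists_ball_subset_of_mem_frontier (hU : IsBoundedLipschitzDomain U)
    {x₀ : EuclideanSpace ℝ (Fin n)} (hx₀ : x₀ ∈ frontier U) :
    ∃ r > 0, ∃ ρ > 0, ∃ w : EuclideanSpace ℝ (Fin n), ‖w‖ + ρ ≤ 1 ∧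
      ∀ y ∈ frontier U ∩ Metric.ball x₀ r, ∀ t ∈ Ioc (0 : ℝ) 1,
        Metric.ball (y + t • w) (2 * ρ * t) ⊆ U := by
  obtain ⟨-, -, h⟩ := hU
  obtain ⟨r, hr, e, he, K, γ, hγ, hiff⟩ := h x₀ hx₀
  set P := (Submodule.span ℝ {e})ᗮ.orthogonalProjectionOnto
  have hK : (0 : ℝ) ≤ K := K.2
  set b : ℝ := min 1 (r / 2) with hb
  have hb0 : 0 < b := lt_min one_pos (by linarith)
  have hb1 : b ≤ 1 := min_le_left _ _
  have hbr : b ≤ r / 2 := min_le_right _ _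
  -- With axis `(K + 2) * a` and radius `a * t`, the height gained over the graph exceeds `(K + 2) *
  -- a * t - (K + 1) * a * t > 0`, while the displacement is below `(K + 3) * a * t < b ≤ r / 2`.
  set a : ℝ := b / (K + 4) with ha
  have ha0 : 0 < a := by positivity
  have hab : (K + 4) * a = b := by rw [ha]; field_simp
  have hs0 : 0 ≤ (K + 2) * a := by positivity
  have hwn : ‖((K + 2 : ℝ) * a) • e‖ = (K + 2) * a := by
    rw [norm_smul, he, mul_one, Real.norm_of_nonneg hs0]
  refine ⟨r / 2, by linarith, a / 2, by linarith, ((K + 2) * a) • e, ?_, ?_⟩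
  · rw [hwn]; nlinarith
  rintro y ⟨hyf, hyr⟩ t ⟨ht0, ht1⟩ x hx
  have hPy : γ (P y) ≤ inner ℝ e y := by
    have hcl : IsClosed {z : EuclideanSpace ℝ (Fin n) | γ (P z) ≤ inner ℝ e z} :=
      isClosed_le (hγ.continuous.comp P.continuous) (by fun_prop)
    have hsub : Metric.ball x₀ r ∩ U ⊆ {z | γ (P z) ≤ inner ℝ e z} :=
      fun z hz => ((hiff z hz.1).1 hz.2).le
    refine closure_minimal hsub hcl (Metric.isOpen_ball.inter_closure ⟨?_, hyf.1⟩)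
    exact Metric.ball_subset_ball (by linarith) hyr
  set u := x - (y + t • ((K + 2 : ℝ) * a) • e) with hu
  have hun : ‖u‖ < a * t := by
    rw [Metric.mem_ball, dist_eq_norm] at hx
    linarith
  have hxy : x = y + (u + t • ((K + 2 : ℝ) * a) • e) := by rw [hu]; abel
  have hPe : P e = 0 :=
    Submodule.orthogonalProjectionOnto_orthogonalComplement_singleton_eq_zero e
  have hPx : P x = P y + P u := by
    rw [hxy, map_add, map_add, map_smul, map_smul, hPe, smul_zero, smul_zero, add_zero]
  have hPu : ‖P u‖ ≤ ‖u‖ := Submodule.norm_orthogonalProjectionOnto_apply_le _ u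
  have hγx : γ (P x) ≤ γ (P y) + K * ‖u‖ := by
    have h1 := hγ.dist_le_mul (P x) (P y)
    rw [hPx, dist_eq_norm (P y + P u), add_sub_cancel_left, Real.dist_eq] at h1
    have h2 := (le_abs_self _).trans h1
    rw [hPx]
    nlinarith [mul_le_mul_of_nonneg_left hPu hK]
  have hinner : (inner ℝ e x : ℝ) = inner ℝ e y + inner ℝ e u + t * ((K + 2) * a) := by
    rw [hxy, inner_add_right, inner_add_right, inner_smul_right, inner_smul_right,
      real_inner_self_eq_norm_sq, he]
    ring
  have hiu : -‖u‖ ≤ inner ℝ e u := by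
    have := abs_real_inner_le_norm e u
    rw [he, one_mul] at this
    exact (abs_le.1 this).1
  refine (hiff x ?_).2 ?_
  · have h1 : dist x y < r / 2 := by
      rw [dist_eq_norm, hxy, add_sub_cancel_left]
      have h2 := norm_add_le u (t • ((K + 2 : ℝ) * a) • e)
      rw [norm_smul t, hwn, Real.norm_of_nonneg ht0.le] at h2
      have h3 : t * ((K + 4) * a) ≤ 1 * b := by
        rw [hab]; exact mul_le_mul_of_nonneg_right ht1 hb0.le
      have h4 : 0 < a * t := by positivity
      nlinarith
    rw [Metric.mem_ball] at hyr ⊢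
    linarith [dist_triangle x y x₀]
  · rw [hinner]
    have h4 : 0 < a * t := by positivity
    have h5 : K * ‖u‖ ≤ K * (a * t) := mul_le_mul_of_nonneg_left hun.le hK
    nlinarith

/-- A uniform cone condition with a measurable choice of the axis. -/
lemma exists_measurable_inward_field (hU : IsBoundedLipschitzDomain U) :
    ∃ ρ > 0, ∃ w : EuclideanSpace ℝ (Fin n) → EuclideanSpace ℝ (Fin n), Measurable w ∧
      ∀ y ∈ frontier U, ‖w y‖ + ρ ≤ 1 ∧
        ∀ t ∈ Ioc (0 : ℝ) 1, Metric.ball (y + t • w y) (2 * ρ * t) ⊆ U := by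
  classical
  have hcpt : IsCompact (frontier U) := Metric.isCompact_of_isClosed_isBounded isClosed_frontier
    (hU.2.1.closure.subset frontier_subset_closure)
  -- Compactness induction runs over arbitrary subsets of the boundary; the measurable superset `T`
  -- is what allows the local axes to be glued measurably.
  suffices h : ∃ ρ > 0, ∃ w : EuclideanSpace ℝ (Fin n) → EuclideanSpace ℝ (Fin n),
      Measurable w ∧ ∃ T, MeasurableSet T ∧ frontier U ⊆ T ∧
        ∀ y ∈ frontier U ∩ T, ‖w y‖ + ρ ≤ 1 ∧
          ∀ t ∈ Ioc (0 : ℝ) 1, Metric.ball (y + t • w y) (2 * ρ * t) ⊆ U by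
    obtain ⟨ρ, hρ, w, hw, T, -, hT, h⟩ := h
    exact ⟨ρ, hρ, w, hw, fun y hy => h y ⟨hy, hT hy⟩⟩
  refine hcpt.induction_on (p := fun s => ∃ ρ > 0, ∃ w : EuclideanSpace ℝ (Fin n) →
      EuclideanSpace ℝ (Fin n), Measurable w ∧ ∃ T, MeasurableSet T ∧ s ⊆ T ∧
        ∀ y ∈ frontier U ∩ T, ‖w y‖ + ρ ≤ 1 ∧
          ∀ t ∈ Ioc (0 : ℝ) 1, Metric.ball (y + t • w y) (2 * ρ * t) ⊆ U) ?_ ?_ ?_ ?_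
  · exact ⟨1, one_pos, 0, measurable_zero, ∅, .empty, Subset.rfl, fun y hy => hy.2.elim⟩
  · rintro s t hst ⟨ρ, hρ, w, hw, T, hT, hsT, h⟩
    exact ⟨ρ, hρ, w, hw, T, hT, hst.trans hsT, h⟩
  · rintro s₁ s₂ ⟨ρ₁, hρ₁, w₁, hw₁, T₁, hT₁, hsT₁, h₁⟩ ⟨ρ₂, hρ₂, w₂, hw₂, T₂, hT₂, hsT₂, h₂⟩
    refine ⟨min ρ₁ ρ₂, lt_min hρ₁ hρ₂, T₁.piecewise w₁ w₂, hw₁.piecewise hT₁ hw₂, T₁ ∪ T₂,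
      hT₁.union hT₂, union_subset_union hsT₁ hsT₂, ?_⟩
    rintro y ⟨hyf, hyT⟩
    have m1 := min_le_left ρ₁ ρ₂
    have m2 := min_le_right ρ₁ ρ₂
    by_cases hy : y ∈ T₁
    · obtain ⟨a, b⟩ := h₁ y ⟨hyf, hy⟩
      rw [piecewise_eq_of_mem _ _ _ hy]
      refine ⟨by linarith, fun t ht => (Metric.ball_subset_ball ?_).trans (b t ht)⟩
      have := ht.1
      gcongr
    · obtain ⟨a, b⟩ := h₂ y ⟨hyf, hyT.resolve_left hy⟩
      rw [piecewise_eq_of_notMem _ _ _ hy]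
      refine ⟨by linarith, fun t ht => (Metric.ball_subset_ball ?_).trans (b t ht)⟩
      have := ht.1
      gcongr
  · intro x hx
    obtain ⟨r, hr, ρ, hρ, w, hwρ, h⟩ := exists_ball_subset_of_mem_frontier hU hx
    exact ⟨Metric.ball x r, mem_nhdsWithin_of_mem_nhds (Metric.ball_mem_nhds x hr), ρ, hρ,
      fun _ => w, measurable_const, Metric.ball x r, Metric.isOpen_ball.measurableSet, Subset.rfl,
      fun y hy => ⟨hwρ, h y hy⟩⟩

/-- The paths with initial point distributed according to `τ` and velocity uniformly distributed
in the ball of radius `ρ` about `w` at the initial point. -/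
noncomputable def inwardPaths (τ : Measure (EuclideanSpace ℝ (Fin n)))
    (w : EuclideanSpace ℝ (Fin n) → EuclideanSpace ℝ (Fin n)) (ρ : ℝ) :
    Measure (EuclideanSpace ℝ (Fin n) × EuclideanSpace ℝ (Fin n)) :=
  (τ.prod (ProbabilityTheory.cond volume (Metric.ball 0 ρ))).map fun x => (x.1, w x.1 + x.2)

variable {τ : Measure (EuclideanSpace ℝ (Fin n))}
  {w : EuclideanSpace ℝ (Fin n) → EuclideanSpace ℝ (Fin n)} {ρ : ℝ}

lemma measurable_inwardPath (hw : Measurable w) :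
    Measurable fun x : EuclideanSpace ℝ (Fin n) × EuclideanSpace ℝ (Fin n) =>
      (x.1, w x.1 + x.2) :=
  measurable_fst.prodMk ((hw.comp measurable_fst).add measurable_snd)

lemma map_fst_inwardPaths (hw : Measurable w) (hρ : 0 < ρ) :
    (inwardPaths τ w ρ).map Prod.fst = τ := by
  have : IsProbabilityMeasure (ProbabilityTheory.cond
      (volume : Measure (EuclideanSpace ℝ (Fin n))) (Metric.ball 0 ρ)) :=
    ProbabilityTheory.cond_isProbabilityMeasure_of_finite
      (Metric.measure_ball_pos volume 0 hρ).ne' measure_ball_lt_top.ne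
  rw [inwardPaths, Measure.map_map measurable_fst (measurable_inwardPath hw)]
  exact Measure.map_fst_prod.trans (by simp)

lemma ae_inwardPaths (hw : Measurable w) (hτ : ∀ᵐ y ∂τ, y ∈ frontier U) :
    ∀ᵐ p ∂inwardPaths τ w ρ, p.1 ∈ frontier U ∧ ‖p.2 - w p.1‖ < ρ := by
  have hmeas : MeasurableSet {p : EuclideanSpace ℝ (Fin n) × EuclideanSpace ℝ (Fin n) |
      p.1 ∈ frontier U ∧ ‖p.2 - w p.1‖ < ρ} :=
    (measurable_fst isClosed_frontier.measurableSet).inter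
      (measurableSet_lt (measurable_snd.sub (hw.comp measurable_fst)).norm measurable_const)
  rw [inwardPaths, ae_map_iff (measurable_inwardPath hw).aemeasurable hmeas]
  have h1 := (Measure.quasiMeasurePreserving_fst (μ := τ) (ν := ProbabilityTheory.cond
    (volume : Measure (EuclideanSpace ℝ (Fin n))) (Metric.ball 0 ρ))).ae hτ
  have h2 := (Measure.quasiMeasurePreserving_snd (μ := τ) (ν := ProbabilityTheory.cond
    (volume : Measure (EuclideanSpace ℝ (Fin n))) (Metric.ball 0 ρ))).ae
    (ProbabilityTheory.ae_cond_mem Metric.isOpen_ball.measurableSet)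
  filter_upwards [h1, h2] with x hx1 hx2
  exact ⟨hx1, by simpa using hx2⟩

instance [IsFiniteMeasure τ] : IsFiniteMeasure (inwardPaths τ w ρ) := by
  unfold inwardPaths; infer_instance

/-- At a fixed time `t ≠ 0` and for a fixed initial point, the position is an affine image, with
factor `t`, of a uniform point of a ball, so null sets are missed; `t = 0` is negligible. -/
lemma occupation_inwardPaths_absolutelyContinuous [IsFiniteMeasure τ]
    (hw : Measurable w) :
    occupation (inwardPaths τ w ρ) ≪ volume := by
  refine Measure.AbsolutelyContinuous.mk fun A hA hA0 => ?_
  rw [occupation, Measure.map_apply measurable_pathPoint hA,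
    Measure.prod_apply_symm (measurable_pathPoint hA), lintegral_eq_zero_iff
      (measurable_measure_prodMk_right (measurable_pathPoint hA))]
  have hne : ∀ᵐ t ∂(volume.restrict (Icc (0 : ℝ) 1)), t ≠ 0 :=
    ae_restrict_of_ae (Measure.ae_ne volume 0)
  filter_upwards [hne] with t ht
  have hmt : MeasurableSet ((fun p : EuclideanSpace ℝ (Fin n) × EuclideanSpace ℝ (Fin n) =>
      (p, t)) ⁻¹' ((fun x => x.1.1 + x.2 • x.1.2) ⁻¹' A)) :=
    measurable_prodMk_right (measurable_pathPoint hA)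
  rw [inwardPaths, Measure.map_apply (measurable_inwardPath hw) hmt,
    Measure.prod_apply (measurable_inwardPath hw hmt)]
  refine (lintegral_congr fun y => ?_).trans lintegral_zero
  refine ProbabilityTheory.cond_absolutelyContinuous ?_
  have : Prod.mk y ⁻¹' ((fun x : EuclideanSpace ℝ (Fin n) × EuclideanSpace ℝ (Fin n) =>
      (x.1, w x.1 + x.2)) ⁻¹' ((fun p => (p, t)) ⁻¹' ((fun x => x.1.1 + x.2 • x.1.2) ⁻¹' A))) =
      (fun u => t • u) ⁻¹' ((fun u => (y + t • w y) + u) ⁻¹' A) := by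
    ext u
    simp only [mem_preimage, smul_add, add_assoc]
  rw [this, Measure.addHaar_preimage_smul volume ht, measure_preimage_add, hA0, mul_zero]

/-- The paths stay inside `U`, at a distance from its complement proportional to the time. -/
lemma ball_subset_of_norm_sub_lt
    (h : ∀ y ∈ frontier U, ‖w y‖ + ρ ≤ 1 ∧
      ∀ t ∈ Ioc (0 : ℝ) 1, Metric.ball (y + t • w y) (2 * ρ * t) ⊆ U)
    {p : EuclideanSpace ℝ (Fin n) × EuclideanSpace ℝ (Fin n)}
    (hp : p.1 ∈ frontier U ∧ ‖p.2 - w p.1‖ < ρ) {t : ℝ} (ht : t ∈ Ioc (0 : ℝ) 1) :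
    Metric.ball (p.1 + t • p.2) (ρ * t) ⊆ U := by
  refine Subset.trans (Metric.ball_subset_ball' ?_) ((h p.1 hp.1).2 t ht)
  rw [dist_add_left, dist_eq_norm, ← smul_sub, norm_smul, Real.norm_of_nonneg ht.1.le]
  nlinarith [mul_le_mul_of_nonneg_left hp.2.le ht.1.le]

lemma ae_norm_inwardPaths (hw : Measurable w) (hτ : ∀ᵐ y ∂τ, y ∈ frontier U)
    (h : ∀ y ∈ frontier U, ‖w y‖ + ρ ≤ 1 ∧
      ∀ t ∈ Ioc (0 : ℝ) 1, Metric.ball (y + t • w y) (2 * ρ * t) ⊆ U) :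
    ∀ᵐ p ∂inwardPaths τ w ρ, ‖p.2‖ ≤ 1 := by
  filter_upwards [ae_inwardPaths hw hτ] with p hp
  have h1 := norm_le_norm_add_norm_sub' p.2 (w p.1)
  linarith [(h p.1 hp.1).1, hp.2]

lemma mem_pathTimes_of_norm_sub_lt (hρ : 0 < ρ)
    (h : ∀ y ∈ frontier U, ‖w y‖ + ρ ≤ 1 ∧
      ∀ t ∈ Ioc (0 : ℝ) 1, Metric.ball (y + t • w y) (2 * ρ * t) ⊆ U)
    {p : EuclideanSpace ℝ (Fin n) × EuclideanSpace ℝ (Fin n)}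
    (hp : p.1 ∈ frontier U ∧ ‖p.2 - w p.1‖ < ρ) {t : ℝ} (ht : t ∈ Ioc (0 : ℝ) 1) :
    t ∈ pathTimes U p :=
  ball_subset_of_norm_sub_lt h hp ht (Metric.mem_ball_self (mul_pos hρ ht.1))

/-- Almost every path starts on the boundary, outside `U`, and is in `U` at all later times, so its
only entry is at time 0, at a point with law `τ`. -/
lemma entryMeasure_inwardPaths (hU : IsOpen U) (hw : Measurable w) (hρ : 0 < ρ)
    (hτ : ∀ᵐ y ∂τ, y ∈ frontier U)
    (h : ∀ y ∈ frontier U, ‖w y‖ + ρ ≤ 1 ∧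
      ∀ t ∈ Ioc (0 : ℝ) 1, Metric.ball (y + t • w y) (2 * ρ * t) ⊆ U)
    {S : Set (EuclideanSpace ℝ (Fin n))} (hS : MeasurableSet S) :
    entryMeasure (inwardPaths τ w ρ) U S = τ S := by
  conv_rhs => rw [← map_fst_inwardPaths (τ := τ) hw hρ, Measure.map_apply measurable_fst hS,
    ← lintegral_indicator_one (measurable_fst hS)]
  rw [entryMeasure_apply _ hU hS]
  refine lintegral_congr_ae ?_
  filter_upwards [ae_inwardPaths hw hτ] with p hp
  have hp0 : p.1 ∉ U := (hU.frontier_eq ▸ hp.1).2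
  have hent : entryTimes (pathTimes U p) = {0} := by
    ext t
    constructor
    · rintro ⟨ht, htU, -⟩
      by_contra hne
      exact htU (mem_pathTimes_of_norm_sub_lt hρ h hp ⟨lt_of_le_of_ne ht.1 (Ne.symm hne), ht.2.le⟩)
    · rintro rfl
      refine ⟨⟨le_rfl, one_pos⟩, by simpa [pathTimes] using hp0, 1, one_pos, fun t ht => ?_⟩
      exact mem_pathTimes_of_norm_sub_lt hρ h hp ⟨ht.1, by linarith [ht.2]⟩
  rw [hent]
  by_cases hpS : p.1 ∈ S
  · have : ({0} : Set ℝ) ∩ pathTimes S p = {0} :=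
      inter_eq_left.2 (by simpa [pathTimes] using hpS)
    simp [this, hpS]
  · have : ({0} : Set ℝ) ∩ pathTimes S p = ∅ := by
      rw [singleton_inter_eq_empty]; simpa [pathTimes] using hpS
    simp [this, hpS]

lemma entryMeasure_map_reversePath_inwardPaths (hU : IsOpen U) (hw : Measurable w) (hρ : 0 < ρ)
    (hτ : ∀ᵐ y ∂τ, y ∈ frontier U)
    (h : ∀ y ∈ frontier U, ‖w y‖ + ρ ≤ 1 ∧
      ∀ t ∈ Ioc (0 : ℝ) 1, Metric.ball (y + t • w y) (2 * ρ * t) ⊆ U)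
    {S : Set (EuclideanSpace ℝ (Fin n))} (hS : MeasurableSet S) :
    entryMeasure ((inwardPaths τ w ρ).map reversePath) U S = 0 := by
  rw [entryMeasure_apply _ hU hS, lintegral_map (measurable_encard_entryTimes hU hS)
    continuous_reversePath.measurable]
  refine (lintegral_congr_ae ?_).trans lintegral_zero
  filter_upwards [ae_inwardPaths hw hτ] with p hp
  have hent : entryTimes (pathTimes U (reversePath p)) = ∅ := by
    rw [eq_empty_iff_forall_notMem]
    rintro t ⟨ht, htU, -⟩
    rw [pathTimes_reversePath] at htU
    exact htU (mem_pathTimes_of_norm_sub_lt hρ h hp ⟨by linarith [ht.2], by linarith [ht.1]⟩)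
  simp [hent]

/-- At time `t` the distance to the complement is at least `ρ * t`, so the collar is left for good
by time `ε / ρ`. -/
lemma occupation_inwardPaths_innerCollar_le [IsFiniteMeasure τ]
    (hU : IsOpen U) (hw : Measurable w) (hρ : 0 < ρ)
    (hτ : ∀ᵐ y ∂τ, y ∈ frontier U)
    (h : ∀ y ∈ frontier U, ‖w y‖ + ρ ≤ 1 ∧
      ∀ t ∈ Ioc (0 : ℝ) 1, Metric.ball (y + t • w y) (2 * ρ * t) ⊆ U) (ε : ℝ) :
    occupation (inwardPaths τ w ρ) (innerCollar U ε) ≤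
      ENNReal.ofReal (ε / ρ) * inwardPaths τ w ρ univ := by
  rw [occupation_apply _ (measurableSet_innerCollar hU ε), ← lintegral_const]
  refine lintegral_mono_ae ?_
  filter_upwards [ae_inwardPaths hw hτ] with p hp
  have hp0 : p.1 ∉ U := (hU.frontier_eq ▸ hp.1).2
  have hsub : pathTimes (innerCollar U ε) p ∩ Icc 0 1 ⊆ Icc 0 (ε / ρ) := by
    rintro t ⟨⟨htU, htε⟩, ht0, ht1⟩
    refine ⟨ht0, ?_⟩
    obtain ⟨z, hz, hd⟩ := Metric.mem_thickening_iff.1 htε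
    have ht : 0 < t := by
      refine lt_of_le_of_ne ht0 fun h0 => hp0 ?_
      simpa [← h0] using htU
    have hzU : z ∉ U := (hU.frontier_eq ▸ hz).2
    have hle : ρ * t ≤ dist (p.1 + t • p.2) z := by
      by_contra! hlt
      exact hzU (ball_subset_of_norm_sub_lt h hp ⟨ht, ht1⟩ (by rwa [Metric.mem_ball']))
    rw [le_div_iff₀ hρ]
    linarith
  calc volume (pathTimes (innerCollar U ε) p ∩ Icc 0 1) ≤ volume (Icc 0 (ε / ρ)) :=
        measure_mono hsub
    _ = ENNReal.ofReal (ε / ρ) := by simp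

end Cone

/-! ### Realising the given boundary measure -/

theorem mainTheorem6 (n : ℕ) (hn : 2 ≤ n) (U : Set (EuclideanSpace ℝ (Fin n)))
    (hU : IsBoundedLipschitzDomain U) (σ : SignedMeasure (frontier U)) :
    ∃ (μ : SignedMeasure (EuclideanSpace ℝ (Fin n))) (m : EuclideanSpace ℝ (Fin n) → ℝ)
      (F : Set (EuclideanSpace ℝ (Fin n)) → Set (EuclideanSpace ℝ (Fin n)) → ℝ),
      IsCauchyFlux μ m F ∧ U ∈ admissibleClass m ∧
        ∀ S : Set (EuclideanSpace ℝ (Fin n)), MeasurableSet S → S ⊆ frontier U →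
          F U S = σ ((↑) ⁻¹' S : Set (frontier U)) := by
  obtain ⟨ρ, hρ, w, hw, h⟩ := exists_measurable_inward_field hU
  have hUo := hU.1
  set J := σ.toJordanDecomposition with hJ
  have hfm : MeasurableSet (frontier U) := isClosed_frontier.measurableSet
  have hae : ∀ τ : Measure (frontier U), ∀ᵐ y ∂τ.map (↑), y ∈ frontier U := fun τ =>
    (ae_map_iff measurable_subtype_coe.aemeasurable hfm).2 (Eventually.of_forall fun y => y.2)
  have hp := hae J.posPart
  have hq := hae J.negPart
  set τp : Measure (EuclideanSpace ℝ (Fin n)) := J.posPart.map (↑) with hτp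
  set τq : Measure (EuclideanSpace ℝ (Fin n)) := J.negPart.map (↑) with hτq
  -- The positive part enters `U` and the reversed paths of the negative part leave it; reversing
  -- `α` exchanges the two roles.
  set α := inwardPaths τp w ρ + (inwardPaths τq w ρ).map reversePath with hα
  have hocc : occupation α =
      occupation (inwardPaths τp w ρ) + occupation (inwardPaths τq w ρ) := by
    rw [hα, occupation_add, occupation_map_reversePath]
  have hac : occupation α ≪ volume := by
    rw [hocc]
    exact (occupation_inwardPaths_absolutelyContinuous hw).add_left
      (occupation_inwardPaths_absolutelyContinuous hw)
  have hv : ∀ᵐ p ∂α, ‖p.2‖ ≤ 1 :=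
    ae_add_measure_iff.2 ⟨ae_norm_inwardPaths hw hp h,
      ae_norm_map_reversePath (ae_norm_inwardPaths hw hq h)⟩
  have hrev : α.map reversePath = (inwardPaths τp w ρ).map reversePath + inwardPaths τq w ρ := by
    rw [hα, Measure.map_add _ _ continuous_reversePath.measurable,
      Measure.map_map continuous_reversePath.measurable continuous_reversePath.measurable]
    congr 1
    convert Measure.map_id
    exact funext reversePath_reversePath
  refine ⟨pathProduction α, _, pathFlux α, isCauchyFlux_pathFlux hv hac, ⟨hUo, ?_⟩, ?_⟩
  · have hC : ENNReal.ofReal ρ⁻¹ * (inwardPaths τp w ρ univ + inwardPaths τq w ρ univ) < ⊤ :=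
      ENNReal.mul_lt_top ENNReal.ofReal_lt_top
        (ENNReal.add_lt_top.2 ⟨measure_lt_top _ _, measure_lt_top _ _⟩)
    refine lt_of_le_of_lt (liminf_le_of_frequently_le' (Eventually.frequently ?_)) hC
    filter_upwards [self_mem_nhdsWithin] with ε hε
    have hε : 0 < ε := hε
    rw [← withDensity_apply _ (measurableSet_innerCollar hUo ε), ← occupation_eq_withDensity hac,
      hocc, Measure.add_apply]
    calc (ENNReal.ofReal ε)⁻¹ * (occupation (inwardPaths τp w ρ) (innerCollar U ε) +
          occupation (inwardPaths τq w ρ) (innerCollar U ε))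
        ≤ (ENNReal.ofReal ε)⁻¹ * (ENNReal.ofReal (ε / ρ) * inwardPaths τp w ρ univ +
          ENNReal.ofReal (ε / ρ) * inwardPaths τq w ρ univ) :=
          mul_le_mul' le_rfl (add_le_add (occupation_inwardPaths_innerCollar_le hUo hw hρ hp h ε)
            (occupation_inwardPaths_innerCollar_le hUo hw hρ hq h ε))
      _ = ENNReal.ofReal ρ⁻¹ * (inwardPaths τp w ρ univ + inwardPaths τq w ρ univ) := by
          rw [← mul_add, ← mul_assoc, ← ENNReal.ofReal_inv_of_pos hε,
            ← ENNReal.ofReal_mul (inv_nonneg.2 hε.le)]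
          congr 2
          field_simp
  · intro S hS _
    have hσ : σ = J.toSignedMeasure := (SignedMeasure.toSignedMeasure_toJordanDecomposition σ).symm
    have hSm : MeasurableSet ((↑) ⁻¹' S : Set (frontier U)) := measurable_subtype_coe hS
    have e1 : entryMeasure α U S = τp S := by
      rw [hα, entryMeasure_add _ _ hUo hS, entryMeasure_inwardPaths hUo hw hρ hp h hS,
        entryMeasure_map_reversePath_inwardPaths hUo hw hρ hq h hS, add_zero]
    have e2 : entryMeasure (α.map reversePath) U S = τq S := by
      rw [hrev, entryMeasure_add _ _ hUo hS, entryMeasure_inwardPaths hUo hw hρ hq h hS,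
        entryMeasure_map_reversePath_inwardPaths hUo hw hρ hp h hS, zero_add]
    rw [hσ, JordanDecomposition.toSignedMeasure, _root_.sub_apply,
      Measure.toSignedMeasure_apply_measurable hSm, Measure.toSignedMeasure_apply_measurable hSm]
    simp only [pathFlux, Measure.real, e1, e2, hτp, hτq,
      Measure.map_apply measurable_subtype_coe hS]
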